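/- Let $V$ be a Euclidean vector space with inner product $(\cdot\mid\cdot)$, and for $0\neq\alpha\in V$ let $s_\alpha(v)=v-\frac{2(\alpha\mid v)}{(\alpha\mid\alpha)}\alpha$ be the reflection in $\alpha^\perp$ and $\alpha^\vee=\frac{2\alpha}{(\alpha\mid\alpha)}$. Let $\Phi\subset V$ be a (reduced) crystallographic root system, i.e. a finite set of non-zero vectors such that $\operatorname{span}_{\mathbb R}(\Phi)=V$, $s_\alpha(\Phi)=\Phi$ and $\Phi\cap\mathbb R\alpha=\{\alpha,-\alpha\}$ for all $\alpha\in\Phi$, and $\frac{2(\alpha\mid\beta)}{(\alpha\mid\alpha)}\in\mathbb Z$ for all $\alpha,\beta\in\Phi$. For $R\subseteq\Phi$ write $W_R=\langle s_\alpha\mid\alpha\in R\rangle$, $W_R(R)=\{w(\alpha)\mid w\in W_R,\ \alpha\in R\}$, $R^\vee=\{\alpha^\vee\mid\alpha\in R\}$, and $L(R)=\operatorname{span}_{\mathbb Z}(R)$, $L(R^\vee)=\operatorname{span}_{\mathbb Z}(R^\vee)$. Let $R\subseteq\Phi$ be non-empty and let $\Phi'\subseteq\Phi$ be a root subsystem (a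 subset with $s_\alpha(\Phi')=\Phi'$ for all $\alpha\in\Phi'$) containing $R$. Then the following statements are equivalent: (a) $\Phi'=W_R(R)$; (b) $W_{\Phi'}=W_R$; (c) $L(\Phi')=L(R)$ and $L((\Phi')^\vee)=L(R^\vee)$. -/

import Mathlib

open scoped InnerProductSpace

namespace EuclideanRoot

/-- The reflection `s_α` of a Euclidean space in the hyperplane orthogonal to `α`; it sends `v` to
`v - (2 (α | v) / (α | α)) α` and is used for `α ≠ 0` only. -/
noncomputable def rootReflection {V : Type*} [NormedAddCommGroup V] [InnerProductSpace ℝ V] (α : V) :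
    V ≃ₗᵢ[ℝ] V :=
  (Submodule.span ℝ {α})ᗮ.reflection

/-- A crystallographic (reduced) root system `Φ` in the Euclidean space `V`. Being spanned by the
finite set `Φ`, the space `V` is then finite-dimensional. -/
structure IsCrystallographicRootSystem {V : Type*} [NormedAddCommGroup V] [InnerProductSpace ℝ V]
    (Φ : Set V) : Prop where
  finite : Φ.Finite
  ne_zero : ∀ α ∈ Φ, α ≠ 0
  span_eq_top : Submodule.span ℝ Φ = ⊤
  reflection_image : ∀ α ∈ Φ, rootReflection α '' Φ = Φ
  inter_line : ∀ α ∈ Φ, Φ ∩ (Submodule.span ℝ {α} : Set V) = {α, -α}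
  crystallographic : ∀ α ∈ Φ, ∀ β ∈ Φ, ∃ m : ℤ, 2 * ⟪α, β⟫_ℝ / ⟪α, α⟫_ℝ = m

/-- A root subsystem of `Φ`: a subset that is stable under the reflections in its own elements
(equivalently, a subset of `Φ` that is a root system in its own real span). -/
structure IsRootSubsystem {V : Type*} [NormedAddCommGroup V] [InnerProductSpace ℝ V]
    (Φ Ψ : Set V) : Prop where
  subset : Ψ ⊆ Φ
  reflection_image : ∀ α ∈ Ψ, rootReflection α '' Ψ = Ψ

/-- The group `W_R` generated by the reflections `s_α`, `α ∈ R`. -/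
noncomputable def reflectionGroup {V : Type*} [NormedAddCommGroup V] [InnerProductSpace ℝ V]
    (R : Set V) : Subgroup (V ≃ₗᵢ[ℝ] V) :=
  Subgroup.closure (rootReflection '' R)

/-- The set `W_R(R)` of all `w(α)` with `w ∈ W_R` and `α ∈ R`. -/
def orbit {V : Type*} [NormedAddCommGroup V] [InnerProductSpace ℝ V] (R : Set V) : Set V :=
  {β | ∃ w ∈ reflectionGroup R, ∃ α ∈ R, w α = β}

/-- The coroot `α^∨ = 2 α / (α | α)`. -/
noncomputable def coroot {V : Type*} [NormedAddCommGroup V] [InnerProductSpace ℝ V] (α : V) : V :=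
  (2 / ⟪α, α⟫_ℝ) • α

/-- The `ℤ`-span `L(R)` of a set of vectors. -/
def lattice {V : Type*} [NormedAddCommGroup V] [InnerProductSpace ℝ V] (R : Set V) :
    Submodule ℤ V :=
  Submodule.span ℤ R

end EuclideanRoot

namespace EuclideanRoot

variable {V : Type*} [NormedAddCommGroup V] [InnerProductSpace ℝ V]

/-! The orbit W_R(R) is a root subsystem inside Φ' with the same reflection group, root lattice and
coroot lattice as R. So (a) gives (b) and (c), and it remains to recover a root subsystem S from its
group or from its two lattices.

Group: the product of the linear forms (· | δ) over the positive roots δ of S is multiplied by det w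
under w ∈ W_S (`prod_inner_rootReflection`). If s_β ∈ W_S but β is proportional to no root of S, the
product vanishes at no generic point of β^⊥; yet s_β fixes such a point and has determinant -1.

Lattices: a root β of L(S) outside S has a strictly shorter non-orthogonal root in S
(`mem_or_exists_shorter`). The same argument for coroots, where lengths are inverted, gives a
strictly longer one. Three lengths in such a chain are impossible (`not_three_lengths`). -/

theorem rootReflection_apply (α v : V) :
    rootReflection α v = v - (2 * ⟪α, v⟫_ℝ / ⟪α, α⟫_ℝ) • α := by
  rw [rootReflection, Submodule.reflection_orthogonal_apply, Submodule.reflection_singleton_apply,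
    real_inner_self_eq_norm_sq]
  simp only [RCLike.ofReal_real_eq_id, id_eq, neg_sub, two_smul, ← add_smul]
  congr 2
  ring

theorem rootReflection_self (α : V) : rootReflection α α = -α :=
  Submodule.reflection_orthogonalComplement_singleton_eq_neg α

theorem rootReflection_rootReflection (α v : V) :
    rootReflection α (rootReflection α v) = v :=
  Submodule.reflection_reflection _ v

theorem rootReflection_smul {c : ℝ} (hc : c ≠ 0) (α : V) :
    rootReflection (c • α) = rootReflection α := by
  simp only [rootReflection, Submodule.span_singleton_smul_eq (IsUnit.mk0 c hc)]

theorem rootReflection_neg (α : V) : rootReflection (-α) = rootReflection α := by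
  simpa using rootReflection_smul (c := -1) (by norm_num) α

theorem inner_rootReflection_left (α x y : V) :
    ⟪rootReflection α x, y⟫_ℝ = ⟪x, rootReflection α y⟫_ℝ := by
  rw [← (rootReflection α).inner_map_map, rootReflection_rootReflection]

theorem rootReflection_map (w : V ≃ₗᵢ[ℝ] V) (α : V) :
    rootReflection (w α) = w * rootReflection α * w⁻¹ := by
  ext v
  obtain ⟨u, rfl⟩ := w.surjective v
  simp [rootReflection_apply]

/-- A set of roots closed under its reflections, crystallographic and reduced, not required to be
finite or to span the space. -/
structure IsReducedRootSet (S : Set V) : Prop where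
  ne_zero : ∀ α ∈ S, α ≠ 0
  reflection_mem : ∀ α ∈ S, ∀ β ∈ S, rootReflection α β ∈ S
  reduced : ∀ α ∈ S, ∀ c : ℝ, c • α ∈ S → c • α = α ∨ c • α = -α
  crystallographic : ∀ α ∈ S, ∀ β ∈ S, ∃ m : ℤ, 2 * ⟪α, β⟫_ℝ / ⟪α, α⟫_ℝ = m

theorem IsCrystallographicRootSystem.isReducedRootSet {Φ : Set V}
    (h : IsCrystallographicRootSystem Φ) : IsReducedRootSet Φ where
  ne_zero := h.ne_zero
  reflection_mem α hα β hβ := by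
    rw [← h.reflection_image α hα]
    exact ⟨β, hβ, rfl⟩
  reduced α hα c hc := by
    have : c • α ∈ Φ ∩ (Submodule.span ℝ {α} : Set V) :=
      ⟨hc, Submodule.smul_mem _ _ (Submodule.mem_span_singleton_self α)⟩
    rwa [h.inter_line α hα] at this
  crystallographic := h.crystallographic

theorem IsReducedRootSet.mono {S T : Set V} (hT : IsReducedRootSet T) (hST : S ⊆ T)
    (h : ∀ α ∈ S, ∀ β ∈ S, rootReflection α β ∈ S) : IsReducedRootSet S where
  ne_zero α hα := hT.ne_zero α (hST hα)
  reflection_mem := h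
  reduced α hα c hc := hT.reduced α (hST hα) c (hST hc)
  crystallographic α hα β hβ := hT.crystallographic α (hST hα) β (hST hβ)

theorem IsRootSubsystem.reflection_mem {Φ Ψ : Set V} (h : IsRootSubsystem Φ Ψ) :
    ∀ α ∈ Ψ, ∀ β ∈ Ψ, rootReflection α β ∈ Ψ := by
  intro α hα β hβ
  rw [← h.reflection_image α hα]
  exact ⟨β, hβ, rfl⟩

/-! ### Duality between roots and coroots -/

section Coroot

theorem coroot_ne_zero {α : V} (h : α ≠ 0) : coroot α ≠ 0 :=
  smul_ne_zero (div_ne_zero two_ne_zero (inner_self_ne_zero.mpr h)) h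

theorem coroot_map (w : V ≃ₗᵢ[ℝ] V) (α : V) : coroot (w α) = w (coroot α) := by
  simp [coroot]

theorem rootReflection_coroot (α : V) : rootReflection (coroot α) = rootReflection α := by
  rcases eq_or_ne α 0 with rfl | h
  · simp [coroot]
  · exact rootReflection_smul (div_ne_zero two_ne_zero (inner_self_ne_zero.mpr h)) α

theorem coroot_neg (α : V) : coroot (-α) = -coroot α := by simp [coroot]

theorem coroot_coroot (α : V) : coroot (coroot α) = α := by
  rcases eq_or_ne α 0 with rfl | h
  · simp [coroot]
  · have h' : ⟪α, α⟫_ℝ ≠ 0 := inner_self_ne_zero.mpr h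
    simp only [coroot, inner_smul_left, inner_smul_right, smul_smul, conj_trivial]
    rw [show 2 / (2 / ⟪α, α⟫_ℝ * (2 / ⟪α, α⟫_ℝ * ⟪α, α⟫_ℝ)) * (2 / ⟪α, α⟫_ℝ) = 1 by field_simp,
      one_smul]

theorem inner_coroot_self {α : V} (h : α ≠ 0) : ⟪coroot α, coroot α⟫_ℝ = 4 / ⟪α, α⟫_ℝ := by
  have h' : ⟪α, α⟫_ℝ ≠ 0 := inner_self_ne_zero.mpr h
  simp only [coroot, inner_smul_left, inner_smul_right, conj_trivial]
  field_simp
  norm_num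

theorem inner_coroot_coroot (α β : V) :
    ⟪coroot α, coroot β⟫_ℝ = 2 / ⟪α, α⟫_ℝ * (2 / ⟪β, β⟫_ℝ) * ⟪α, β⟫_ℝ := by
  simp only [coroot, inner_smul_left, inner_smul_right, conj_trivial]
  ring

/-- Dualizing transposes the Cartan integers and keeps the reflections, so results on roots apply to
coroots. -/
theorem IsReducedRootSet.coroot_image {S : Set V} (h : IsReducedRootSet S) :
    IsReducedRootSet (coroot '' S) where
  ne_zero := by
    rintro _ ⟨α, hα, rfl⟩
    exact coroot_ne_zero (h.ne_zero α hα)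
  reflection_mem := by
    rintro _ ⟨α, hα, rfl⟩ _ ⟨β, hβ, rfl⟩
    rw [rootReflection_coroot, ← coroot_map]
    exact ⟨_, h.reflection_mem α hα β hβ, rfl⟩
  reduced := by
    rintro _ ⟨α, hα, rfl⟩ c ⟨β, hβ, hc⟩
    have hβ' : β = (2 / ⟪coroot β, coroot β⟫_ℝ * (c * (2 / ⟪α, α⟫_ℝ))) • α := by
      conv_lhs => rw [← coroot_coroot β, coroot]
      rw [mul_smul, hc, mul_smul, coroot]
    rw [← hc, ← coroot_neg]
    rw [hβ'] at hβ
    rcases h.reduced α hα _ hβ with e | e <;> rw [← hβ'] at e <;> simp [e]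
  crystallographic := by
    rintro _ ⟨α, hα, rfl⟩ _ ⟨β, hβ, rfl⟩
    obtain ⟨m, hm⟩ := h.crystallographic β hβ α hα
    refine ⟨m, ?_⟩
    have hα' : ⟪α, α⟫_ℝ ≠ 0 := inner_self_ne_zero.mpr (h.ne_zero α hα)
    have hβ' : ⟪β, β⟫_ℝ ≠ 0 := inner_self_ne_zero.mpr (h.ne_zero β hβ)
    rw [inner_coroot_self (h.ne_zero α hα), inner_coroot_coroot, ← hm, real_inner_comm β α]
    field_simp
    ring

end Coroot

/-! ### Root lengths and integral sums of roots -/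

namespace IsReducedRootSet

variable {S : Set V} (hS : IsReducedRootSet S)
include hS

theorem neg_mem {α : V} (hα : α ∈ S) : -α ∈ S := by
  simpa [rootReflection_self] using hS.reflection_mem α hα α hα

theorem inner_self_pos {α : V} (hα : α ∈ S) : 0 < ⟪α, α⟫_ℝ :=
  real_inner_self_pos.mpr (hS.ne_zero α hα)

theorem inner_mul_inner_lt {α β : V} (hα : α ∈ S) (hβ : β ∈ S) (h₁ : β ≠ α) (h₂ : β ≠ -α) :
    ⟪α, β⟫_ℝ * ⟪α, β⟫_ℝ < ⟪α, α⟫_ℝ * ⟪β, β⟫_ℝ := by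
  have hpos := hS.inner_self_pos hα
  have hne : β - (⟪α, β⟫_ℝ / ⟪α, α⟫_ℝ) • α ≠ 0 := by
    intro h0
    have h := sub_eq_zero.mp h0
    have := hS.reduced α hα _ (h ▸ hβ)
    rw [← h] at this
    exact this.elim h₁ h₂
  have h := real_inner_self_pos.mpr hne
  simp only [inner_sub_left, inner_sub_right, inner_smul_left, inner_smul_right, conj_trivial,
    real_inner_comm α β] at h
  have e : ⟪α, α⟫_ℝ * (⟪β, β⟫_ℝ - ⟪α, β⟫_ℝ / ⟪α, α⟫_ℝ * ⟪α, β⟫_ℝ - ⟪α, β⟫_ℝ / ⟪α, α⟫_ℝ *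
      (⟪α, β⟫_ℝ - ⟪α, β⟫_ℝ / ⟪α, α⟫_ℝ * ⟪α, α⟫_ℝ)) =
      ⟪α, α⟫_ℝ * ⟪β, β⟫_ℝ - ⟪α, β⟫_ℝ * ⟪α, β⟫_ℝ := by
    field_simp
    ring
  have := mul_pos hpos h
  linarith

/-- The Cartan integers of two non-proportional roots have product less than `4`. -/
theorem exists_cartan {α β : V} (hα : α ∈ S) (hβ : β ∈ S) (h₁ : β ≠ α) (h₂ : β ≠ -α) :
    ∃ p q : ℤ, 2 * ⟪α, β⟫_ℝ = p * ⟪α, α⟫_ℝ ∧ 2 * ⟪α, β⟫_ℝ = q * ⟪β, β⟫_ℝ ∧ p * q < 4 := by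
  obtain ⟨p, hp⟩ := hS.crystallographic α hα β hβ
  obtain ⟨q, hq⟩ := hS.crystallographic β hβ α hα
  have hα' := hS.inner_self_pos hα
  have hβ' := hS.inner_self_pos hβ
  rw [div_eq_iff hα'.ne'] at hp
  rw [div_eq_iff hβ'.ne', real_inner_comm] at hq
  refine ⟨p, q, hp, hq, ?_⟩
  have h := hS.inner_mul_inner_lt hα hβ h₁ h₂
  have h' : (p * q : ℝ) * (⟪α, α⟫_ℝ * ⟪β, β⟫_ℝ) < 4 * (⟪α, α⟫_ℝ * ⟪β, β⟫_ℝ) := by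
    calc (p * q : ℝ) * (⟪α, α⟫_ℝ * ⟪β, β⟫_ℝ) = (p * ⟪α, α⟫_ℝ) * (q * ⟪β, β⟫_ℝ) := by ring
      _ = (2 * ⟪α, β⟫_ℝ) * (2 * ⟪α, β⟫_ℝ) := by rw [← hp, ← hq]
      _ < _ := by linarith
  exact_mod_cast lt_of_mul_lt_mul_right h' (mul_pos hα' hβ').le

/-- Both Cartan integers are negative with product below 4, so one is -1, and the corresponding
reflection produces the sum. -/
theorem add_mem_of_inner_neg {α β : V} (hα : α ∈ S) (hβ : β ∈ S) (h : ⟪α, β⟫_ℝ < 0)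
    (hne : β ≠ -α) : α + β ∈ S := by
  have hα' := hS.inner_self_pos hα
  have hβ' := hS.inner_self_pos hβ
  have h₁ : β ≠ α := by
    rintro rfl
    exact hα'.not_gt h
  obtain ⟨p, q, hp, hq, hpq⟩ := hS.exists_cartan hα hβ h₁ hne
  have hp0 : p < 0 := by
    have : (p : ℝ) < 0 := by
      by_contra! h0
      have := mul_nonneg h0 hα'.le
      linarith
    exact_mod_cast this
  have hq0 : q < 0 := by
    have : (q : ℝ) < 0 := by
      by_contra! h0
      have := mul_nonneg h0 hβ'.le
      linarith
    exact_mod_cast this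
  have hor : p = -1 ∨ q = -1 := by
    by_contra! hc
    have h1 : p ≤ -2 := by omega
    have h2 : q ≤ -2 := by omega
    nlinarith
  rcases hor with rfl | rfl
  · have := hS.reflection_mem α hα β hβ
    rw [rootReflection_apply, hp, mul_div_cancel_right₀ _ hα'.ne'] at this
    simpa [add_comm] using this
  · have := hS.reflection_mem β hβ α hα
    rw [rootReflection_apply, real_inner_comm, hq, mul_div_cancel_right₀ _ hβ'.ne'] at this
    simpa using this

/-- Up to sign, the smaller Cartan integer is 1 and the other, 2 or 3, is the ratio of squared
lengths. -/
theorem two_mul_le_and_le_three_mul {α β : V} (hα : α ∈ S) (hβ : β ∈ S) (h : ⟪α, β⟫_ℝ ≠ 0)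
    (hlt : ⟪α, α⟫_ℝ < ⟪β, β⟫_ℝ) :
    2 * ⟪α, α⟫_ℝ ≤ ⟪β, β⟫_ℝ ∧ ⟪β, β⟫_ℝ ≤ 3 * ⟪α, α⟫_ℝ := by
  have hα' := hS.inner_self_pos hα
  wlog hpos : 0 < ⟪α, β⟫_ℝ generalizing α
  · have := this (hS.neg_mem hα) (by simpa using h) (by simpa using hlt) (by simpa using hα')
      (by simpa using lt_of_le_of_ne (not_lt.mp hpos) h)
    simpa using this
  obtain ⟨p, q, hp, hq, hpq⟩ := hS.exists_cartan hα hβ (by rintro rfl; simp at hlt)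
    (by rintro rfl; simp at hlt)
  have hβ' := hS.inner_self_pos hβ
  have hq0 : 0 < q := by
    have : (0 : ℝ) < q := by
      by_contra! h0
      have := mul_nonpos_of_nonpos_of_nonneg h0 hβ'.le
      linarith
    exact_mod_cast this
  have hqp : q < p := by
    have hq1 : (0 : ℝ) < q := by exact_mod_cast hq0
    have : (q : ℝ) < p := by
      by_contra! h0
      have h1 := mul_le_mul_of_nonneg_right h0 hα'.le
      have h2 := mul_lt_mul_of_pos_left hlt hq1
      linarith
    exact_mod_cast this
  have hq1 : q = 1 := by nlinarith
  subst hq1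
  have h2 : (2 : ℝ) ≤ p := by exact_mod_cast (by omega : (2 : ℤ) ≤ p)
  have h3 : (p : ℝ) ≤ 3 := by exact_mod_cast (by omega : p ≤ 3)
  have e : ⟪β, β⟫_ℝ = p * ⟪α, α⟫_ℝ := by rw [← hp, hq]; simp
  rw [e]
  exact ⟨mul_le_mul_of_nonneg_right h2 hα'.le, mul_le_mul_of_nonneg_right h3 hα'.le⟩

/-- A chain of non-orthogonal roots has at most two lengths. -/
theorem not_three_lengths {α β γ : V} (hα : α ∈ S) (hβ : β ∈ S) (hγ : γ ∈ S)
    (hαβ : ⟪α, β⟫_ℝ ≠ 0) (hβγ : ⟪β, γ⟫_ℝ ≠ 0) (h₁ : ⟪α, α⟫_ℝ < ⟪β, β⟫_ℝ)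
    (h₂ : ⟪β, β⟫_ℝ < ⟪γ, γ⟫_ℝ) : False := by
  have hα' := hS.inner_self_pos hα
  have hβ' := hS.inner_self_pos hβ
  have h3 := (hS.two_mul_le_and_le_three_mul hα hβ hαβ h₁).1
  have h4 := (hS.two_mul_le_and_le_three_mul hβ hγ hβγ h₂).1
  -- The ratio of γ to α is at least 2 · 2 > 3, so they must be orthogonal; reflecting α in β then
  -- gives a root of the same length not orthogonal to γ.
  by_cases h : ⟪α, γ⟫_ℝ = 0
  · have h0 : ⟪rootReflection β α, γ⟫_ℝ ≠ 0 := by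
      rw [rootReflection_apply, inner_sub_left, real_inner_smul_left, h, zero_sub, neg_ne_zero,
        real_inner_comm]
      exact mul_ne_zero (div_ne_zero (mul_ne_zero two_ne_zero hαβ) hβ'.ne') hβγ
    have e : ⟪rootReflection β α, rootReflection β α⟫_ℝ = ⟪α, α⟫_ℝ :=
      (rootReflection β).inner_map_map α α
    have := (hS.two_mul_le_and_le_three_mul (hS.reflection_mem β hβ α hα) hγ h0
      (by linarith)).2
    linarith
  · have := (hS.two_mul_le_and_le_three_mul hα hγ h (by linarith)).2
    linarith

theorem exists_multiset_sum_eq {β : V} (h : β ∈ Submodule.span ℤ S) :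
    ∃ m : Multiset V, (∀ γ ∈ m, γ ∈ S) ∧ m.sum = β := by
  induction h using Submodule.span_induction with
  | mem x hx => exact ⟨{x}, by simpa using hx, by simp⟩
  | zero => exact ⟨0, by simp, by simp⟩
  | add x y _ _ hx hy =>
    obtain ⟨m, hm, rfl⟩ := hx
    obtain ⟨n, hn, rfl⟩ := hy
    refine ⟨m + n, fun γ hγ => ?_, by simp⟩
    exact (Multiset.mem_add.mp hγ).elim (hm γ) (hn γ)
  | smul a x _ hx =>
    obtain ⟨m, hm, rfl⟩ := hx
    have hnat : ∀ k : ℕ, ∃ n : Multiset V, (∀ γ ∈ n, γ ∈ S) ∧ n.sum = k • m.sum := fun k =>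
      ⟨k • m, fun γ hγ => hm γ (Multiset.mem_of_mem_nsmul hγ), Multiset.sum_nsmul m k⟩
    obtain ⟨k, rfl | rfl⟩ := a.eq_nat_or_neg
    · simpa using hnat k
    · obtain ⟨n, hn, hk⟩ := hnat k
      refine ⟨n.map Neg.neg, fun γ hγ => ?_, ?_⟩
      · obtain ⟨δ, hδ, rfl⟩ := Multiset.mem_map.mp hγ
        exact hS.neg_mem (hn δ hδ)
      · rw [Multiset.sum_map_neg', hk]
        simp

/-- Two summands with negative inner product cancel or merge into one root, shortening the sum. Once
none remain, any summand γ of a longer sum works: the rest r is non-zero and (γ | r) ≥ 0, so |γ +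
r|² > |γ|². -/
theorem mem_or_exists_shorter_of_sum (m : Multiset V) (hm : ∀ γ ∈ m, γ ∈ S)
    (h0 : m.sum ≠ 0) :
    m.sum ∈ S ∨ ∃ γ ∈ S, ⟪γ, γ⟫_ℝ < ⟪m.sum, m.sum⟫_ℝ ∧ 0 < ⟪γ, m.sum⟫_ℝ := by
  induction hn : m.card using Nat.strong_induction_on generalizing m with
  | _ n ih =>
  by_cases hneg : ∃ γ δ m', m = γ ::ₘ δ ::ₘ m' ∧ ⟪γ, δ⟫_ℝ < 0
  · obtain ⟨γ, δ, m', rfl, hlt⟩ := hneg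
    have hγ : γ ∈ S := hm γ (by simp)
    have hδ : δ ∈ S := hm δ (by simp)
    have hm' : ∀ x ∈ m', x ∈ S := fun x hx => hm x (by simp [hx])
    by_cases he : δ = -γ
    · have e : (γ ::ₘ δ ::ₘ m').sum = m'.sum := by simp [he]
      rw [e] at h0 ⊢
      exact ih m'.card (by simp at hn; omega) m' hm' h0 rfl
    · have e : (γ ::ₘ δ ::ₘ m').sum = ((γ + δ) ::ₘ m').sum := by simp [add_assoc]
      rw [e] at h0 ⊢
      refine ih ((γ + δ) ::ₘ m').card (by simp at hn ⊢; omega) _ (fun x hx => ?_) h0 rfl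
      rcases Multiset.mem_cons.mp hx with rfl | hx
      · exact hS.add_mem_of_inner_neg hγ hδ hlt he
      · exact hm' x hx
  · push Not at hneg
    have hle : ∀ γ r, γ ::ₘ r ≤ m → 0 ≤ ⟪γ, r.sum⟫_ℝ := by
      intro γ r
      induction r using Multiset.induction_on with
      | empty => simp
      | cons δ r ih =>
        intro hr
        obtain ⟨u, hu⟩ := Multiset.le_iff_exists_add.mp hr
        rw [Multiset.sum_cons, inner_add_right]
        refine add_nonneg (hneg γ δ (r + u) (by rw [hu, Multiset.cons_add, Multiset.cons_add])) ?_
        exact ih (((Multiset.cons_le_cons_iff γ).mpr (Multiset.le_cons_self r δ)).trans hr)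
    clear ih hneg hn
    induction m using Multiset.induction_on with
    | empty => simp at h0
    | cons γ m' _ =>
      have hγ : γ ∈ S := hm γ (by simp)
      induction m' using Multiset.induction_on with
      | empty => exact Or.inl (by simpa using hγ)
      | cons δ t _ =>
        have h1 := hle γ (δ ::ₘ t) le_rfl
        have h2 := hle δ t (Multiset.le_cons_self _ γ)
        have hγ' := hS.inner_self_pos hγ
        have hδ' := hS.inner_self_pos (hm δ (by simp))
        have hr : (δ ::ₘ t).sum ≠ 0 := by
          intro h
          have h5 : ⟪δ, (δ ::ₘ t).sum⟫_ℝ = 0 := by rw [h, inner_zero_right]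
          rw [Multiset.sum_cons, inner_add_right] at h5
          linarith
        refine Or.inr ⟨γ, hγ, ?_, ?_⟩
        · have hr' := real_inner_self_pos.mpr hr
          rw [Multiset.sum_cons γ, real_inner_add_add_self]
          linarith
        · rw [Multiset.sum_cons γ, inner_add_right]
          linarith

theorem mem_or_exists_shorter {β : V} (h : β ∈ Submodule.span ℤ S) (h0 : β ≠ 0) :
    β ∈ S ∨ ∃ γ ∈ S, ⟪γ, γ⟫_ℝ < ⟪β, β⟫_ℝ ∧ 0 < ⟪γ, β⟫_ℝ := by
  obtain ⟨m, hm, rfl⟩ := hS.exists_multiset_sum_eq h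
  exact hS.mem_or_exists_shorter_of_sum m hm h0

end IsReducedRootSet

/-- A root whose root and coroot lie in the root and coroot lattices of a root subsystem belongs
to this subsystem. -/
theorem mem_of_mem_lattice {S T : Set V} (hT : IsReducedRootSet T) (hS : IsReducedRootSet S)
    (hST : S ⊆ T) {β : V} (hβ : β ∈ T) (h₁ : β ∈ lattice S)
    (h₂ : coroot β ∈ lattice (coroot '' S)) : β ∈ S := by
  have hβ0 := hT.ne_zero β hβ
  rcases hS.mem_or_exists_shorter h₁ hβ0 with h | ⟨γ, hγ, hγl, hγp⟩
  · exact h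
  -- A shorter coroot belongs to a longer root, which completes a chain of three lengths through β.
  rcases hS.coroot_image.mem_or_exists_shorter h₂ (coroot_ne_zero hβ0) with
    ⟨δ, hδ, he⟩ | ⟨_, ⟨δ, hδ, rfl⟩, hδl, hδp⟩
  · rw [← coroot_coroot β, ← he, coroot_coroot]
    exact hδ
  exfalso
  have hδ' := hS.inner_self_pos hδ
  have hβ' := hT.inner_self_pos hβ
  refine hT.not_three_lengths (hST hγ) hβ (hST hδ) hγp.ne' ?_ hγl ?_
  · intro h
    rw [inner_coroot_coroot, real_inner_comm β δ, h, mul_zero] at hδp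
    exact lt_irrefl _ hδp
  · rw [inner_coroot_self hβ0, inner_coroot_self (hS.ne_zero δ hδ)] at hδl
    exact (div_lt_div_iff_of_pos_left (by norm_num) hδ' hβ').mp hδl

/-! ### The subsystem generated by R -/

section Orbit

variable {R : Set V}

theorem rootReflection_mem_reflectionGroup {α : V} (h : α ∈ R) :
    rootReflection α ∈ reflectionGroup R :=
  Subgroup.subset_closure ⟨α, h, rfl⟩

theorem subset_orbit : R ⊆ orbit R := fun α hα => ⟨1, one_mem _, α, hα, rfl⟩

theorem map_mem_orbit {w : V ≃ₗᵢ[ℝ] V} (hw : w ∈ reflectionGroup R) {β : V} (hβ : β ∈ orbit R) :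
    w β ∈ orbit R := by
  obtain ⟨u, hu, α, hα, rfl⟩ := hβ
  exact ⟨w * u, mul_mem hw hu, α, hα, rfl⟩

theorem rootReflection_mem_of_mem_orbit {β : V} (hβ : β ∈ orbit R) :
    rootReflection β ∈ reflectionGroup R := by
  obtain ⟨w, hw, α, hα, rfl⟩ := hβ
  rw [rootReflection_map]
  exact mul_mem (mul_mem hw (rootReflection_mem_reflectionGroup hα)) (inv_mem hw)

theorem reflectionGroup_orbit : reflectionGroup (orbit R) = reflectionGroup R := by
  apply le_antisymm
  · refine (Subgroup.closure_le _).mpr ?_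
    rintro _ ⟨β, hβ, rfl⟩
    exact rootReflection_mem_of_mem_orbit hβ
  · exact Subgroup.closure_mono (Set.image_mono subset_orbit)

theorem map_mem_of_mem_reflectionGroup {S : Set V}
    (h : ∀ α ∈ R, ∀ β ∈ S, rootReflection α β ∈ S) {w : V ≃ₗᵢ[ℝ] V}
    (hw : w ∈ reflectionGroup R) : ∀ β ∈ S, w β ∈ S := by
  induction hw using Subgroup.closure_induction'' with
  | mem x hx =>
    obtain ⟨α, hα, rfl⟩ := hx
    exact h α hα
  | inv_mem x hx =>
    obtain ⟨α, hα, rfl⟩ := hx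
    have : (rootReflection α)⁻¹ = rootReflection α :=
      inv_eq_of_mul_eq_one_right (LinearIsometryEquiv.ext (rootReflection_rootReflection α))
    rw [this]
    exact h α hα
  | one => exact fun β hβ => hβ
  | mul x y _ _ hx hy => exact fun β hβ => hx _ (hy β hβ)

theorem orbit_subset {S : Set V} (hRS : R ⊆ S)
    (h : ∀ α ∈ S, ∀ β ∈ S, rootReflection α β ∈ S) : orbit R ⊆ S := by
  rintro _ ⟨w, hw, α, hα, rfl⟩
  exact map_mem_of_mem_reflectionGroup (fun α hα => h α (hRS hα)) hw α (hRS hα)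

theorem IsReducedRootSet.orbit {S : Set V} (hS : IsReducedRootSet S) (hRS : R ⊆ S) :
    IsReducedRootSet (orbit R) :=
  hS.mono (orbit_subset hRS hS.reflection_mem) fun _ hα _ hβ =>
    map_mem_orbit (rootReflection_mem_of_mem_orbit hα) hβ

theorem rootReflection_mem_lattice {S T : Set V} (hS : IsReducedRootSet S) (hTS : T ⊆ S)
    {α : V} (hα : α ∈ T) {β : V} (hβ : β ∈ S) (hβ' : β ∈ lattice T) :
    rootReflection α β ∈ lattice T := by
  obtain ⟨m, hm⟩ := hS.crystallographic α (hTS hα) β hβ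
  rw [rootReflection_apply, hm, Int.cast_smul_eq_zsmul]
  exact sub_mem hβ' (Submodule.smul_mem _ _ (Submodule.subset_span hα))

theorem lattice_orbit {S : Set V} (hS : IsReducedRootSet S) (hRS : R ⊆ S) :
    lattice (orbit R) = lattice R := by
  apply le_antisymm
  · refine Submodule.span_le.mpr ?_
    rintro _ ⟨w, hw, α, hα, rfl⟩
    -- Intersecting with S keeps the vectors roots, for which the reflection coefficients are
    -- integers.
    refine (map_mem_of_mem_reflectionGroup (S := S ∩ lattice R) (fun γ hγ β hβ => ?_) hw α
      ⟨hRS hα, Submodule.subset_span hα⟩).2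
    exact ⟨hS.reflection_mem γ (hRS hγ) β hβ.1, rootReflection_mem_lattice hS hRS hγ hβ.1 hβ.2⟩
  · exact Submodule.span_mono subset_orbit

theorem reflectionGroup_coroot_image : reflectionGroup (coroot '' R) = reflectionGroup R := by
  simp only [reflectionGroup, Set.image_image, rootReflection_coroot]

theorem orbit_coroot_image : orbit (coroot '' R) = coroot '' orbit R := by
  ext x
  simp only [orbit, reflectionGroup_coroot_image, Set.mem_ofPred_eq, Set.mem_image]
  constructor
  · rintro ⟨w, hw, _, ⟨α, hα, rfl⟩, rfl⟩
    exact ⟨w α, ⟨w, hw, α, hα, rfl⟩, coroot_map w α⟩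
  · rintro ⟨_, ⟨w, hw, α, hα, rfl⟩, rfl⟩
    exact ⟨w, hw, _, ⟨α, hα, rfl⟩, (coroot_map w α).symm⟩

end Orbit

/-! ### Anti-invariance of the product of positive roots -/

section Determinant

theorem det_rootReflection [FiniteDimensional ℝ V] {α : V} (h : α ≠ 0) :
    LinearMap.det ((rootReflection α).toLinearEquiv : V →ₗ[ℝ] V) = -1 := by
  have := (Submodule.span ℝ {α})ᗮ.det_reflection
  rw [Submodule.orthogonal_orthogonal, finrank_span_singleton h, pow_one] at this
  exact this

open Classical in
-- The reflection permutes the positive roots up to signs σ. The root γ contributes -1; the other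
-- sign changes cancel in pairs δ, -s_γ(δ).
theorem prod_inner_rootReflection {S : Set V} (hS : IsReducedRootSet S) (P : Finset V) (v : V)
    (hv : ∀ δ ∈ S, ⟪v, δ⟫_ℝ ≠ 0) (hP : ∀ δ, δ ∈ P ↔ δ ∈ S ∧ 0 < ⟪v, δ⟫_ℝ) {γ : V} (hγ : γ ∈ S)
    (x : V) :
    ∏ δ ∈ P, ⟪rootReflection γ x, δ⟫_ℝ = -∏ δ ∈ P, ⟪x, δ⟫_ℝ := by
  wlog hpos : 0 < ⟪v, γ⟫_ℝ generalizing γ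
  · rw [← rootReflection_neg]
    refine this (hS.neg_mem hγ) ?_
    rw [inner_neg_right]
    exact neg_pos.mpr (lt_of_le_of_ne (not_lt.mp hpos) (hv γ hγ))
  have hγP : γ ∈ P := (hP γ).mpr ⟨hγ, hpos⟩
  -- the sign of a reflected positive root, and the positive root it determines
  let σ : V → ℝ := fun δ => if 0 < ⟪v, rootReflection γ δ⟫_ℝ then 1 else -1
  let τ : V → V := fun δ => σ δ • rootReflection γ δ
  have hσσ : ∀ δ, σ δ * σ δ = 1 := fun δ => by
    by_cases h : 0 < ⟪v, rootReflection γ δ⟫_ℝ <;> simp [σ, h]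
  have hτS : ∀ δ ∈ S, τ δ ∈ S := by
    intro δ hδ
    have h1 := hS.reflection_mem γ hγ δ hδ
    have h2 := hS.neg_mem h1
    by_cases h : 0 < ⟪v, rootReflection γ δ⟫_ℝ
    · simpa [τ, σ, h] using h1
    · simpa [τ, σ, h] using h2
  have hτpos : ∀ δ ∈ S, 0 < ⟪v, τ δ⟫_ℝ := by
    intro δ hδ
    have h1 := hv _ (hS.reflection_mem γ hγ δ hδ)
    by_cases h : 0 < ⟪v, rootReflection γ δ⟫_ℝ
    · simp [τ, σ, h]
    · simpa [τ, σ, h] using lt_of_le_of_ne (not_lt.mp h) h1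
  have hτP : ∀ δ ∈ P, τ δ ∈ P := fun δ hδ =>
    (hP _).mpr ⟨hτS δ ((hP δ).mp hδ).1, hτpos δ ((hP δ).mp hδ).1⟩
  have hreflτ : ∀ δ, rootReflection γ (τ δ) = σ δ • δ := fun δ => by
    simp only [τ, map_smul, rootReflection_rootReflection]
  have hστ : ∀ δ ∈ P, σ (τ δ) = σ δ := by
    intro δ hδ
    have hδ' := ((hP δ).mp hδ).2
    have e : σ (τ δ) = if 0 < ⟪v, σ δ • δ⟫_ℝ then 1 else -1 := by rw [← hreflτ]
    rw [e, inner_smul_right]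
    by_cases h : 0 < ⟪v, rootReflection γ δ⟫_ℝ
    · simp [σ, h, hδ']
    · simp [σ, h, hδ'.le]
  have hττ : ∀ δ ∈ P, τ (τ δ) = δ := by
    intro δ hδ
    change σ (τ δ) • rootReflection γ (τ δ) = δ
    rw [hreflτ, hστ δ hδ, smul_smul, hσσ, one_smul]
  have hσγ : σ γ = -1 := by
    have : ¬ (0 < ⟪v, rootReflection γ γ⟫_ℝ) := by
      rw [rootReflection_self, inner_neg_right]
      linarith
    simp only [σ, if_neg this]
  have hτγ : τ γ = γ := by
    simp only [τ, hσγ, rootReflection_self, neg_smul, one_smul, neg_neg]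
  have hσ : ∏ δ ∈ P, σ δ = -1 := by
    rw [← Finset.mul_prod_erase P σ hγP, hσγ]
    have : ∏ δ ∈ P.erase γ, σ δ = 1 := by
      refine Finset.prod_involution (fun δ _ => τ δ) ?_ ?_ ?_ ?_
      · intro δ hδ
        rw [hστ δ (Finset.mem_of_mem_erase hδ), hσσ]
      · intro δ hδ h1 h2
        obtain ⟨hne, hδP⟩ := Finset.mem_erase.mp hδ
        have hs : σ δ = -1 := by
          by_cases h : 0 < ⟪v, rootReflection γ δ⟫_ℝ
          · exact absurd (by simp [σ, h]) h1
          · simp [σ, h]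
        have h3 : rootReflection γ δ = -δ := by
          have h2' : σ δ • rootReflection γ δ = δ := h2
          rw [hs, neg_smul, one_smul] at h2'
          rw [← h2', neg_neg]
          congr 1
        rw [rootReflection_apply] at h3
        -- A pair with δ = -s_γ(δ) would make δ proportional to γ, hence equal to it by positivity.
        have h4 : δ = (⟪γ, δ⟫_ℝ / ⟪γ, γ⟫_ℝ) • γ := by
          have h5 : (2 : ℝ) • δ = (2 : ℝ) • (⟪γ, δ⟫_ℝ / ⟪γ, γ⟫_ℝ) • γ := by
            rw [smul_smul, ← mul_div_assoc, two_smul]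
            rw [sub_eq_iff_eq_add] at h3
            nth_rewrite 1 [h3]
            abel
          exact smul_right_injective V (two_ne_zero (α := ℝ)) h5
        obtain ⟨hδS, hδpos⟩ := (hP δ).mp hδP
        have := hS.reduced γ hγ _ (h4 ▸ hδS)
        rw [← h4] at this
        rcases this with e | e
        · exact hne e
        · rw [e, inner_neg_right] at hδpos
          linarith
      · intro δ hδ
        obtain ⟨hne, hδP⟩ := Finset.mem_erase.mp hδ
        refine Finset.mem_erase.mpr ⟨fun h => hne ?_, hτP δ hδP⟩
        have := hττ δ hδP
        rw [h, hτγ] at this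
        exact this.symm
      · intro δ hδ
        exact hττ δ (Finset.mem_of_mem_erase hδ)
    rw [this, mul_one]
  calc ∏ δ ∈ P, ⟪rootReflection γ x, δ⟫_ℝ = ∏ δ ∈ P, σ δ * ⟪x, τ δ⟫_ℝ := by
        refine Finset.prod_congr rfl fun δ _ => ?_
        rw [inner_rootReflection_left, inner_smul_right, ← mul_assoc, hσσ, one_mul]
    _ = (∏ δ ∈ P, σ δ) * ∏ δ ∈ P, ⟪x, τ δ⟫_ℝ := Finset.prod_mul_distrib
    _ = -∏ δ ∈ P, ⟪x, δ⟫_ℝ := by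
        rw [hσ, neg_one_mul]
        congr 1
        exact Finset.prod_nbij' τ τ hτP hτP hττ hττ fun _ _ => rfl

/-- No (δ | ·) vanishes on all of β^⊥, and finitely many proper subspaces do not cover a real vector
space. -/
theorem exists_generic_orthogonal [FiniteDimensional ℝ V] {S : Set V} (hfin : S.Finite) (β : V)
    (h : ∀ δ ∈ S, δ ∉ Submodule.span ℝ {β}) :
    ∃ v : V, ⟪β, v⟫_ℝ = 0 ∧ ∀ δ ∈ S, ⟪v, δ⟫_ℝ ≠ 0 := by
  have : Finite S := hfin
  obtain ⟨v, hv, hne⟩ := Module.Dual.exists_forall_mem_ne_zero_of_forall_exists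
    (Submodule.span ℝ {β})ᗮ (fun δ : S => (innerₛₗ ℝ (δ : V) : V →ₗ[ℝ] ℝ)) (by
      rintro ⟨δ, hδ⟩
      by_contra! hc
      apply h δ hδ
      rw [← Submodule.orthogonal_orthogonal (Submodule.span ℝ {β})]
      refine (Submodule.mem_orthogonal' _ _).mpr fun u hu => ?_
      simpa using hc u hu)
  refine ⟨v, Submodule.mem_orthogonal_singleton_iff_inner_right.mp hv, fun δ hδ => ?_⟩
  rw [real_inner_comm]
  exact hne ⟨δ, hδ⟩

/-- A reflection in the reflection group of a root system is the reflection in one of its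
roots. -/
theorem mem_span_of_rootReflection_mem [FiniteDimensional ℝ V] {S : Set V}
    (hS : IsReducedRootSet S) (hfin : S.Finite) {β : V} (hβ : β ≠ 0)
    (h : rootReflection β ∈ reflectionGroup S) : ∃ δ ∈ S, δ ∈ Submodule.span ℝ {β} := by
  classical
  by_contra! hc
  obtain ⟨v, hβv, hv⟩ := exists_generic_orthogonal hfin β hc
  let P : Finset V := hfin.toFinset.filter fun δ => 0 < ⟪v, δ⟫_ℝ
  have hP : ∀ δ, δ ∈ P ↔ δ ∈ S ∧ 0 < ⟪v, δ⟫_ℝ := by simp [P]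
  have hrefl : ∀ γ ∈ S, ∀ x : V, ∏ δ ∈ P, ⟪rootReflection γ x, δ⟫_ℝ =
      LinearMap.det ((rootReflection γ).toLinearEquiv : V →ₗ[ℝ] V) * ∏ δ ∈ P, ⟪x, δ⟫_ℝ := by
    intro γ hγ x
    rw [prod_inner_rootReflection hS P v hv hP hγ, det_rootReflection (hS.ne_zero γ hγ),
      neg_one_mul]
  have key : ∀ w ∈ reflectionGroup S, ∀ x : V, ∏ δ ∈ P, ⟪w x, δ⟫_ℝ =
      LinearMap.det (w.toLinearEquiv : V →ₗ[ℝ] V) * ∏ δ ∈ P, ⟪x, δ⟫_ℝ := by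
    intro w hw
    induction hw using Subgroup.closure_induction'' with
    | mem x hx =>
      obtain ⟨α, hα, rfl⟩ := hx
      exact hrefl α hα
    | inv_mem x hx =>
      obtain ⟨α, hα, rfl⟩ := hx
      have : (rootReflection α)⁻¹ = rootReflection α :=
        inv_eq_of_mul_eq_one_right (LinearIsometryEquiv.ext (rootReflection_rootReflection α))
      rw [this]
      exact hrefl α hα
    | one =>
      intro x
      have : (((1 : V ≃ₗᵢ[ℝ] V).toLinearEquiv : V →ₗ[ℝ] V)) = LinearMap.id := rfl
      rw [this, LinearMap.det_id, one_mul]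
      rfl
    | mul x y _ _ hx hy =>
      intro u
      have : (((x * y).toLinearEquiv : V →ₗ[ℝ] V)) =
        (x.toLinearEquiv : V →ₗ[ℝ] V) ∘ₗ (y.toLinearEquiv : V →ₗ[ℝ] V) := rfl
      rw [this, LinearMap.det_comp, mul_assoc, ← hy]
      exact hx (y u)
  have h1 := key _ h v
  have hfix : rootReflection β v = v := by simp [rootReflection_apply, hβv]
  rw [hfix, det_rootReflection hβ] at h1
  have h2 : 0 < ∏ δ ∈ P, ⟪v, δ⟫_ℝ := Finset.prod_pos fun δ hδ => ((hP δ).mp hδ).2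
  linarith

end Determinant

end EuclideanRoot

/-! ### The equivalences -/

open EuclideanRoot in
theorem mainTheorem1 {V : Type*} [NormedAddCommGroup V] [InnerProductSpace ℝ V]
    (Φ : Set V) (hΦ : EuclideanRoot.IsCrystallographicRootSystem Φ)
    (R : Set V) (hRΦ : R ⊆ Φ) (hR : R.Nonempty)
    (Φ' : Set V) (hΦ' : EuclideanRoot.IsRootSubsystem Φ Φ') (hRΦ' : R ⊆ Φ') :
    List.TFAE [
      Φ' = EuclideanRoot.orbit R,
      EuclideanRoot.reflectionGroup Φ' = EuclideanRoot.reflectionGroup R,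
      EuclideanRoot.lattice Φ' = EuclideanRoot.lattice R ∧
        EuclideanRoot.lattice (EuclideanRoot.coroot '' Φ') =
          EuclideanRoot.lattice (EuclideanRoot.coroot '' R)] := by
  have hT : IsReducedRootSet Φ := hΦ.isReducedRootSet
  have hT' : IsReducedRootSet Φ' := hT.mono hΦ'.subset hΦ'.reflection_mem
  have hO : IsReducedRootSet (orbit R) := hT.orbit hRΦ
  have hOΦ' : orbit R ⊆ Φ' := orbit_subset hRΦ' hT'.reflection_mem
  have hL : lattice (orbit R) = lattice R := lattice_orbit hT hRΦ
  have hL' : lattice (coroot '' orbit R) = lattice (coroot '' R) := by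
    rw [← orbit_coroot_image]
    exact lattice_orbit hT.coroot_image (Set.image_mono hRΦ)
  have : FiniteDimensional ℝ V := by
    refine ⟨⟨hΦ.finite.toFinset, ?_⟩⟩
    simpa using hΦ.span_eq_top
  tfae_have 1 → 2 := by
    rintro rfl
    exact reflectionGroup_orbit
  tfae_have 1 → 3 := by
    rintro rfl
    exact ⟨hL, hL'⟩
  tfae_have 2 → 1 := by
    intro h
    refine (Set.Subset.antisymm hOΦ' fun β hβ => ?_).symm
    have hmem : rootReflection β ∈ reflectionGroup (orbit R) := by
      rw [reflectionGroup_orbit, ← h]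
      exact rootReflection_mem_reflectionGroup hβ
    obtain ⟨δ, hδ, hδβ⟩ := mem_span_of_rootReflection_mem hO
      (hΦ.finite.subset (hOΦ'.trans hΦ'.subset)) (hT'.ne_zero β hβ) hmem
    obtain ⟨c, rfl⟩ := Submodule.mem_span_singleton.mp hδβ
    -- The root found is only proportional to β; reducedness of Φ' makes it ±β.
    rcases hT'.reduced β hβ c (hOΦ' hδ) with e | e
    · rwa [e] at hδ
    · rw [e] at hδ
      simpa using hO.neg_mem hδ
  tfae_have 3 → 1 := by
    rintro ⟨h₁, h₂⟩
    refine (Set.Subset.antisymm hOΦ' fun β hβ => ?_).symm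
    refine mem_of_mem_lattice hT' hO hOΦ' hβ ?_ ?_
    · rw [hL, ← h₁]
      exact Submodule.subset_span hβ
    · rw [hL', ← h₂]
      exact Submodule.subset_span ⟨β, hβ, rfl⟩
  tfae_finish
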